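/- Let $n, r \ge 0$ be integers and $[n] = \{1,\dots,n\}$. Let $x = (x_{i,j})_{i,j\in[n]}$ be a matrix of variables and $\mathbb{Z}[x] = \mathbb{Z}[x_{1,1},x_{1,2},\dots,x_{n,n}]$. Call a real $n\times n$ matrix totally nonnegative if all its minors are nonnegative, and call $f \in \mathbb{Z}[x]$ totally nonnegative if $f(A) \ge 0$ for every totally nonnegative real $n\times n$ matrix $A$. Fix $r$-element multisets $M = (m_1 \le \dots \le m_r) = 1^{\alpha_1}\cdots n^{\alpha_n}$ and $O = (o_1 \le \dots \le o_r) = 1^{\beta_1}\cdots n^{\beta_n}$ of $[n]$ (that is, $i$ occurs $\alpha_i$ times in $M$ and $j$ occurs $\beta_j$ times in $O$), and put $$\mathcal{A}_{M,O} = \mathrm{span}_{\mathbb{Z}}\{x_{m_1,o_{w_1}}\cdots x_{m_r,o_{w_r}} \mid w \in \mathfrak{S}_r\}.$$ For an $n \times n$ matrix $C = (c_{i,j})$ of nonnegative integers with row sums $(\alpha_1,\dots,\alpha_n)$ and column sums $(\beta_1,\dots,\beta_n)$, let $C^* = (c^*_{i,j})$ with $c^*_{i,j} = \sum_{a \le i,\,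 b \le j} c_{a,b}$, and define $w(C) \in \mathfrak{S}_r$ as follows: write $\prod_{i,j} x_{i,j}^{c_{i,j}}$ with its variables in lexicographic order of index pairs as $x_{m_1,u_1}\cdots x_{m_r,u_r}$; list the positions $1,\dots,r$ as $j_1,\dots,j_r$, first the positions of the letter $1$ in $u = u_1\cdots u_r$ in increasing order, then those of the letter $2$ in increasing order, and so on; and set $w(C)_{j_i} = i$ for $i = 1,\dots,r$. Let $C, D$ be two $n\times n$ matrices of nonnegative integers, both with row sums $(\alpha_1,\dots,\alpha_n)$ and column sums $(\beta_1,\dots,\beta_n)$, and let $$f(x) = \prod_{i,j} x_{i,j}^{c_{i,j}} - \prod_{i,j} x_{i,j}^{d_{i,j}}.$$ Then $f(x) \in \mathcal{A}_{M,O}$, and the following are equivalent. (i) $f(x)$ is totally nonnegative. (ii) $C^* \ge D^*$ in the componentwise order. (iii) $w(C) \le w(D)$ in the Bruhat order on $\mathfrak{S}_r$, where $v \le w$ means that each reduced expression for $w$ in the adjacent transpositions contains a (not necessarily consecutive) subword that is a reduced expression for $v$. (iv) $f(x)$ is a finite (possibly empty) sum of products of the form $\det(x_{I,J})\,x_{u_1,v_1}\cdots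 x_{u_{r-2},v_{r-2}}$, each lying in $\mathcal{A}_{M,O}$, where $I, J \subseteq [n]$, $|I| = |J| = 2$ and $x_{I,J}$ is the submatrix of $x$ with rows $I$ and columns $J$. (For $r < 2$ there are no such products.) -/

import Mathlib

/-! # Monomials in the entries of an `n × n` matrix, total nonnegativity, and the Bruhat order

The indices `1, …, n` are `Fin n`, the indices `1, …, r` are `Fin r`, and an `r`-element multiset
of `[n]` is a nondecreasing `r`-tuple, that is, an order homomorphism `Fin r →o Fin n`. -/

namespace TNNOrder

open Finset

/-! ### Minors and total nonnegativity -/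

/-- The `(I, J)`-minor of `A`, for sets `I`, `J` of row and column indices of equal size. -/
def minor {R : Type*} [CommRing R] {n : ℕ} (A : Matrix (Fin n) (Fin n) R)
    (I J : Finset (Fin n)) (h : I.card = J.card) : R :=
  (A.submatrix (I.orderEmbOfFin rfl) (J.orderEmbOfFin h.symm)).det

/-- A real square matrix is totally nonnegative if all of its minors are nonnegative. -/
def IsTNN {n : ℕ} (A : Matrix (Fin n) (Fin n) ℝ) : Prop :=
  ∀ (I J : Finset (Fin n)) (h : I.card = J.card), 0 ≤ minor A I J h

/-- The polynomial ring `ℤ[x] = ℤ[x₁₁, x₁₂, …, xₙₙ]`. -/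
abbrev MatPoly (n : ℕ) : Type := MvPolynomial (Fin n × Fin n) ℤ

/-- The matrix `x = (x_{i,j})` of variables. -/
noncomputable def xMat (n : ℕ) : Matrix (Fin n) (Fin n) (MatPoly n) :=
  Matrix.of fun i j => MvPolynomial.X (i, j)

/-- A polynomial `f(x) ∈ ℤ[x]` is totally nonnegative if `f(A) ≥ 0` for every totally
nonnegative real matrix `A`. -/
def IsTNNPoly {n : ℕ} (f : MatPoly n) : Prop :=
  ∀ A : Matrix (Fin n) (Fin n) ℝ, IsTNN A → 0 ≤ MvPolynomial.aeval (fun p => A p.1 p.2) f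

/-! ### The multigraded components -/

/-- `y^{v,w} = y_{v₁,w₁} ⋯ y_{v_r,w_r}` for an `r × r` matrix `y`. -/
def permMonomial {R : Type*} [CommRing R] {r : ℕ} (y : Matrix (Fin r) (Fin r) R)
    (v w : Equiv.Perm (Fin r)) : R :=
  ∏ k, y (v k) (w k)

/-- The generalized submatrix `x_{M,O}`, with entries `x_{m_i, o_j}`. -/
noncomputable def genSubmatrix {n r : ℕ} (M O : Fin r →o Fin n) :
    Matrix (Fin r) (Fin r) (MatPoly n) :=
  (xMat n).submatrix M O

/-- The component `A_{M,O}`: the `ℤ`-span of the monomials `(x_{M,O})^{e,w}`. -/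
noncomputable def component {n r : ℕ} (M O : Fin r →o Fin n) : Submodule ℤ (MatPoly n) :=
  Submodule.span ℤ (Set.range fun w : Equiv.Perm (Fin r) => permMonomial (genSubmatrix M O) 1 w)

/-- The multiplicity of `i` in the multiset `M`. -/
def mult {n r : ℕ} (M : Fin r →o Fin n) (i : Fin n) : ℕ :=
  (univ.filter fun k => M k = i).card

/-- `C` has row sums given by the multiplicities in `M` and column sums given by those in `O`. -/
def HasMargins {n r : ℕ} (M O : Fin r →o Fin n) (C : Matrix (Fin n) (Fin n) ℕ) : Prop :=
  (∀ i, ∑ j, C i j = mult M i) ∧ (∀ j, ∑ i, C i j = mult O j)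

/-- The monomial `∏ x_{i,j} ^ c_{i,j}`. -/
noncomputable def matMonomial {n : ℕ} (C : Matrix (Fin n) (Fin n) ℕ) : MatPoly n :=
  ∏ i, ∏ j, xMat n i j ^ C i j

/-- The matrix `C*`, whose `(i, j)` entry is the sum of the entries `c_{a,b}` with `a ≤ i`,
`b ≤ j`. -/
def partialSums {n : ℕ} (C : Matrix (Fin n) (Fin n) ℕ) : Matrix (Fin n) (Fin n) ℕ :=
  Matrix.of fun i j => ∑ a ∈ Iic i, ∑ b ∈ Iic j, C a b

/-! ### The permutation of an exponent matrix -/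

/-- The index pairs of the variables of `∏ x_{i,j} ^ c_{i,j}`, with multiplicity, in
lexicographic order. -/
def lexVariables {n : ℕ} (C : Matrix (Fin n) (Fin n) ℕ) : List (Fin n × Fin n) :=
  (List.finRange n).flatMap fun i => (List.finRange n).flatMap fun j =>
    List.replicate (C i j) (i, j)

theorem length_lexVariables {n : ℕ} (C : Matrix (Fin n) (Fin n) ℕ) :
    (lexVariables C).length = ∑ i, ∑ j, C i j := by
  simp [lexVariables, List.length_flatMap, Fin.sum_univ_def]

theorem HasMargins.length_eq {n r : ℕ} {M O : Fin r →o Fin n} {C : Matrix (Fin n) (Fin n) ℕ}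
    (h : HasMargins M O C) : (lexVariables C).length = r := by
  rw [length_lexVariables, Finset.sum_congr rfl fun i _ => h.1 i]
  have key := card_eq_sum_card_fiberwise (s := (univ : Finset (Fin r)))
    (t := (univ : Finset (Fin n))) (f := M) (fun _ _ => by simp)
  rw [card_univ, Fintype.card_fin] at key
  exact key.symm

/-- The word `u = u₁ ⋯ u_r` of column indices of the variables in lexicographic order. -/
def columnWord {n r : ℕ} {M O : Fin r →o Fin n} {C : Matrix (Fin n) (Fin n) ℕ}
    (h : HasMargins M O C) : Fin r → Fin n :=
  fun k => ((lexVariables C).get (k.cast h.length_eq.symm)).2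

/-- The permutation `w(C)`. The permutation `Tuple.sort u` lists the positions
`j₁, j₂, …, j_r`: first those of the smallest letter of `u` from left to right, then those of the
next letter, and so on. The permutation `w = w(C)` is given by `w_{j_i} = i`. -/
def wPerm {n r : ℕ} {M O : Fin r →o Fin n} {C : Matrix (Fin n) (Fin n) ℕ}
    (h : HasMargins M O C) : Equiv.Perm (Fin r) :=
  (Tuple.sort (columnWord h))⁻¹

/-! ### The Bruhat order on the symmetric group -/

/-- The adjacent transpositions, the standard generators `s₁, …, s_{r-1}` of `S_r`
(indexed from `0` to `r - 2`). -/
def adjSwap (r : ℕ) (i : Fin (r - 1)) : Equiv.Perm (Fin r) :=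
  Equiv.swap ⟨i, by omega⟩ ⟨i + 1, by omega⟩

/-- The word `a` in the standard generators is a reduced expression for `w`: its product is `w`
and no shorter word has product `w`. -/
def IsReducedExpr {r : ℕ} (a : List (Fin (r - 1))) (w : Equiv.Perm (Fin r)) : Prop :=
  (a.map (adjSwap r)).prod = w ∧
    ∀ b : List (Fin (r - 1)), (b.map (adjSwap r)).prod = w → a.length ≤ b.length

/-- The Bruhat order: `v ≤ w` if each reduced expression for `w` contains a subword (not
necessarily of consecutive letters) that is a reduced expression for `v`. -/
def BruhatLE {r : ℕ} (v w : Equiv.Perm (Fin r)) : Prop :=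
  ∀ a : List (Fin (r - 1)), IsReducedExpr a w →
    ∃ b : List (Fin (r - 1)), b.Sublist a ∧ IsReducedExpr b v

/-! ### Products of a `2 × 2` minor and a monomial -/

/-- `p` lies in `A_{M,O}` and has the form `det(x_{I,J}) x_{u₁,v₁} ⋯ x_{u_{r-2},v_{r-2}}` with
`|I| = |J| = 2` (so that `r ≥ 2`). -/
def IsMinorProduct {n r : ℕ} (M O : Fin r →o Fin n) (p : MatPoly n) : Prop :=
  p ∈ component M O ∧
    ∃ (I J : Finset (Fin n)) (hI : I.card = 2) (hJ : J.card = 2) (s : ℕ) (_ : s + 2 = r)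
      (u v : Fin s → Fin n),
      p = minor (xMat n) I J (hI.trans hJ.symm) * ∏ k, xMat n (u k) (v k)

/-- `f` is a finite (possibly empty) sum of products as in `IsMinorProduct`. -/
def IsSumOfMinorProducts {n r : ℕ} (M O : Fin r →o Fin n) (f : MatPoly n) : Prop :=
  ∃ L : List (MatPoly n), (∀ p ∈ L, IsMinorProduct M O p) ∧ f = L.sum

end TNNOrder

namespace TNNOrder

open Finset

/-! ### The word of an exponent matrix -/

/-! Every condition is compared with dominance: `rectSum D p q ≤ rectSum C p q` for all `p`, `q`.
Total nonnegativity implies dominance by evaluation at a step matrix, where a monomial becomes a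
power of 2 with exponent `rectSum`. Conversely, if `C ≠ D` dominates, `exists_rectangle` finds two
antidiagonal units of `D` that can be moved to the diagonal without losing dominance by `C`. Each
such move changes the monomial by a 2 × 2 minor times a monomial, so repeated moves telescope to
(iv), and (iv) gives (i) because minors and entries are nonnegative. For Bruhat order,
`bruhatLE_iff_rk_le` turns the subword definition into an inequality of rank functions, by induction
on the last letter of a reduced word. At the ends of blocks of equal letters of `M` and `O` the
ranks of `w(C)` are exactly the values of `rectSum` (`mapCount_wPerm`). Inside a block, `w(C)` and
its inverse increase, and `mapCount_le_of_blocks` interpolates. -/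

theorem eq_of_monotone_of_card_fiber_eq {n r : ℕ} {f g : Fin r → Fin n} (hf : Monotone f)
    (hg : Monotone g)
    (h : ∀ i, (univ.filter fun k => f k = i).card = (univ.filter fun k => g k = i).card) :
    f = g := by
  apply List.ofFn_injective
  refine List.Perm.eq_of_sortedLE (List.sortedLE_ofFn_iff.2 hf) (List.sortedLE_ofFn_iff.2 hg) ?_
  rw [← Multiset.coe_eq_coe]
  have key : ∀ f : Fin r → Fin n, ((List.ofFn f : List (Fin n)) : Multiset (Fin n))
      = Multiset.map f univ.val := by
    intro f
    rw [List.ofFn_eq_map]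
    rfl
  rw [key, key]
  ext i
  have := h i
  simp only [Multiset.count_map]
  simpa only [Finset.card, Finset.filter_val, eq_comm] using this

theorem prod_map_lexVariables {n : ℕ} {R : Type*} [CommMonoid R] (C : Matrix (Fin n) (Fin n) ℕ)
    (g : Fin n × Fin n → R) :
    ((lexVariables C).map g).prod = ∏ i, ∏ j, g (i, j) ^ C i j := by
  simp only [lexVariables, List.flatMap_def, List.map_flatten, List.prod_flatten, List.map_map,
    Function.comp_def, List.map_replicate, List.prod_replicate, Fin.prod_univ_def]

/-- The `k`-th variable of `∏ x_{i,j} ^ c_{i,j}` in lexicographic order. -/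
def letter {n r : ℕ} {C : Matrix (Fin n) (Fin n) ℕ} (h : (lexVariables C).length = r)
    (k : Fin r) : Fin n × Fin n :=
  (lexVariables C).get (k.cast h.symm)

theorem prod_letter {n r : ℕ} {R : Type*} [CommMonoid R] {C : Matrix (Fin n) (Fin n) ℕ}
    (h : (lexVariables C).length = r) (g : Fin n × Fin n → R) :
    ∏ k, g (letter h k) = ∏ i, ∏ j, g (i, j) ^ C i j := by
  subst h
  rw [← prod_map_lexVariables, ← List.prod_ofFn]
  congr 1
  conv_rhs => rw [← List.ofFn_get (lexVariables C), List.map_ofFn]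
  rfl

theorem sum_letter {n r : ℕ} {C : Matrix (Fin n) (Fin n) ℕ}
    (h : (lexVariables C).length = r) (g : Fin n × Fin n → ℕ) :
    ∑ k, g (letter h k) = ∑ i, ∑ j, C i j * g (i, j) := by
  have := prod_letter (R := Multiplicative ℕ) h (fun p => Multiplicative.ofAdd (g p))
  have := congrArg Multiplicative.toAdd this
  simpa [toAdd_prod] using this

theorem card_letter {n r : ℕ} {C : Matrix (Fin n) (Fin n) ℕ}
    (h : (lexVariables C).length = r) (P : Fin n × Fin n → Prop) [DecidablePred P] :
    (univ.filter fun k => P (letter h k)).card = ∑ i, ∑ j, if P (i, j) then C i j else 0 := by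
  have := sum_letter h (fun p => if P p then 1 else 0)
  rw [Finset.card_filter, this]
  simp

theorem pairwise_lexVariables {n : ℕ} (C : Matrix (Fin n) (Fin n) ℕ) :
    (lexVariables C).Pairwise fun p q => p.1 < q.1 ∨ (p.1 = q.1 ∧ p.2 ≤ q.2) := by
  have hlt : (List.finRange n).Pairwise (· < ·) := List.pairwise_lt_finRange n
  rw [lexVariables, List.pairwise_flatMap]
  constructor
  · intro i _
    rw [List.pairwise_flatMap]
    constructor
    · intro j _
      simp [List.pairwise_replicate]
    · refine hlt.imp ?_
      intro a b hab x hx y hy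
      rw [List.mem_replicate] at hx hy
      rw [hx.2, hy.2]
      exact Or.inr ⟨rfl, hab.le⟩
  · refine hlt.imp ?_
    intro a b hab x hx y hy
    simp only [List.mem_flatMap, List.mem_replicate] at hx hy
    obtain ⟨c, _, _, rfl⟩ := hx
    obtain ⟨d, _, _, rfl⟩ := hy
    exact Or.inl hab

theorem letter_lex {n r : ℕ} {C : Matrix (Fin n) (Fin n) ℕ}
    (h : (lexVariables C).length = r) {k l : Fin r} (hkl : k < l) :
    (letter h k).1 < (letter h l).1 ∨
      ((letter h k).1 = (letter h l).1 ∧ (letter h k).2 ≤ (letter h l).2) :=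
  List.pairwise_iff_get.1 (pairwise_lexVariables C) _ _ (by simpa using hkl)

section Margins

variable {n r : ℕ} {M O : Fin r →o Fin n} {C : Matrix (Fin n) (Fin n) ℕ}

theorem letter_fst (h : HasMargins M O C) (k : Fin r) : (letter h.length_eq k).1 = M k := by
  have : (fun k => (letter h.length_eq k).1) = M := by
    refine eq_of_monotone_of_card_fiber_eq ?_ M.monotone ?_
    · intro k l hkl
      rcases hkl.eq_or_lt with rfl | hkl
      · exact le_rfl
      · rcases letter_lex h.length_eq hkl with h1 | h1
        · exact h1.le
        · exact h1.1.le
    · intro i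
      rw [card_letter h.length_eq (fun p => p.1 = i)]
      have := h.1 i
      rw [mult] at this
      rw [← this, Finset.sum_eq_single i]
      · simp
      · intro b _ hb
        simp [hb]
      · simp
  exact congrFun this k

theorem letter_snd (h : HasMargins M O C) (k : Fin r) :
    (letter h.length_eq k).2 = columnWord h k := rfl

theorem columnWord_eq (h : HasMargins M O C) (k : Fin r) : columnWord h k = O (wPerm h k) := by
  have : columnWord h ∘ Tuple.sort (columnWord h) = O := by
    refine eq_of_monotone_of_card_fiber_eq (Tuple.monotone_sort _) O.monotone ?_
    intro j
    have h2 := h.2 j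
    rw [mult] at h2
    rw [← h2]
    have h3 := card_letter h.length_eq (fun p => p.2 = j)
    simp only [Finset.sum_ite_eq', Finset.mem_univ, if_true] at h3
    rw [← h3]
    refine Finset.card_equiv (Tuple.sort (columnWord h)) ?_
    intro k
    simp only [mem_filter, mem_univ, true_and, Function.comp_apply]
    exact Iff.rfl
  rw [← this]
  simp [wPerm]

theorem matMonomial_eq_permMonomial (h : HasMargins M O C) :
    matMonomial C = permMonomial (genSubmatrix M O) 1 (wPerm h) := by
  rw [matMonomial, ← prod_letter h.length_eq (fun p => xMat n p.1 p.2), permMonomial]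
  refine Finset.prod_congr rfl fun k _ => ?_
  rw [letter_fst h, letter_snd h, columnWord_eq]
  rfl

theorem matMonomial_mem_component (h : HasMargins M O C) : matMonomial C ∈ component M O := by
  rw [matMonomial_eq_permMonomial h]
  exact Submodule.subset_span ⟨_, rfl⟩

/-- Within one row the lexicographic order makes the column word nondecreasing, and stable sorting
keeps equal letters in order. -/
theorem wPerm_lt_of_row_eq (h : HasMargins M O C) {k l : Fin r} (hkl : k < l) (hM : M k = M l) :
    wPerm h k < wPerm h l := by
  have hu : columnWord h k ≤ columnWord h l := by
    rcases letter_lex h.length_eq hkl with h1 | h1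
    · rw [letter_fst h, letter_fst h, hM] at h1
      exact absurd h1 (lt_irrefl _)
    · exact h1.2
  obtain ⟨h1, h2⟩ := (Tuple.eq_sort_iff (f := columnWord h)
    (σ := Tuple.sort (columnWord h))).1 rfl
  by_contra hcon
  have hne : wPerm h l ≠ wPerm h k := fun h => hkl.ne ((wPerm _).injective h).symm
  have hlt : wPerm h l < wPerm h k := lt_of_le_of_ne (not_lt.1 hcon) hne
  have hm := h1 hlt.le
  simp only [Function.comp_apply, wPerm, Equiv.Perm.coe_inv, Equiv.apply_symm_apply] at hm
  have := h2 _ _ hlt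
  simp only [wPerm, Equiv.Perm.coe_inv, Equiv.apply_symm_apply] at this
  exact absurd (this (le_antisymm hm hu)) (not_lt.2 hkl.le)

theorem wPerm_inv_lt_of_col_eq (h : HasMargins M O C) {k l : Fin r} (hkl : k < l)
    (hO : O k = O l) : (wPerm h)⁻¹ k < (wPerm h)⁻¹ l := by
  obtain ⟨h1, h2⟩ := (Tuple.eq_sort_iff (f := columnWord h)
    (σ := Tuple.sort (columnWord h))).1 rfl
  have := h2 k l hkl
  simp only [columnWord_eq] at this
  simp only [wPerm, inv_inv, Equiv.Perm.coe_inv, Equiv.symm_apply_apply] at this ⊢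
  exact this hO

end Margins

/-! ### Partial sums over initial rectangles -/

/-- The sum of the entries of `C` in the first `p` rows and the first `q` columns. -/
def rectSum {n : ℕ} (C : Matrix (Fin n) (Fin n) ℕ) (p q : ℕ) : ℕ :=
  ∑ x : Fin n × Fin n with x.1.val < p ∧ x.2.val < q, C x.1 x.2

theorem partialSums_eq_rectSum {n : ℕ} (C : Matrix (Fin n) (Fin n) ℕ) (i j : Fin n) :
    partialSums C i j = rectSum C (i.val + 1) (j.val + 1) := by
  refine (Finset.sum_product (Iic i) (Iic j) fun x => C x.1 x.2).symm.trans ?_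
  refine Finset.sum_congr ?_ fun _ _ => rfl
  ext x
  rw [mem_product, mem_filter, mem_Iic, mem_Iic, Fin.le_def, Fin.le_def]
  simp only [mem_univ, true_and, Nat.lt_succ_iff]

theorem rectSum_le_iff {n : ℕ} (C D : Matrix (Fin n) (Fin n) ℕ) :
    (∀ i j, partialSums D i j ≤ partialSums C i j) ↔
      ∀ p q, rectSum D p q ≤ rectSum C p q := by
  simp only [partialSums_eq_rectSum]
  refine ⟨fun h p q => ?_, fun h i j => h _ _⟩
  rcases Nat.eq_zero_or_pos p with rfl | hp
  · simp [rectSum]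
  rcases Nat.eq_zero_or_pos q with rfl | hq
  · simp [rectSum]
  rcases Nat.eq_zero_or_pos n with rfl | hn
  · simp [rectSum]
  -- Bounds beyond `n` add no entries, so positive `p` and `q` can be capped at `n`.
  have key : ∀ C : Matrix (Fin n) (Fin n) ℕ, rectSum C p q
      = rectSum C (min (p - 1) (n - 1) + 1) (min (q - 1) (n - 1) + 1) := by
    intro C
    refine Finset.sum_congr ?_ fun _ _ => rfl
    ext x
    simp only [mem_filter, mem_univ, true_and]
    omega
  rw [key, key]
  exact h ⟨min (p - 1) (n - 1), by omega⟩ ⟨min (q - 1) (n - 1), by omega⟩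

theorem rectSum_add_single {n : ℕ} (B : Matrix (Fin n) (Fin n) ℕ) (i j : Fin n) (p q : ℕ) :
    rectSum (B + Matrix.single i j 1) p q
      = rectSum B p q + if i.val < p ∧ j.val < q then 1 else 0 := by
  simp only [rectSum, Matrix.add_apply, Finset.sum_add_distrib, Matrix.single_apply]
  congr 1
  rw [Finset.sum_filter, Finset.sum_eq_single (i, j)]
  · simp
  · rintro ⟨a, b⟩ _ hab
    have : ¬ (i = a ∧ j = b) := fun h => hab (by rw [h.1, h.2])
    simp [this]
  · simp

theorem rectSum_eq_add {n : ℕ} (C : Matrix (Fin n) (Fin n) ℕ) (p : ℕ) {k q : ℕ} (hkq : k ≤ q) :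
    rectSum C p q = rectSum C p k +
      ∑ x : Fin n × Fin n with x.1.val < p ∧ k ≤ x.2.val ∧ x.2.val < q, C x.1 x.2 := by
  rw [rectSum, rectSum, ← Finset.sum_union]
  · refine Finset.sum_congr ?_ fun _ _ => rfl
    ext x
    simp only [mem_filter, mem_univ, true_and, mem_union]
    omega
  · rw [Finset.disjoint_left]
    intro x
    simp only [mem_filter, mem_univ, true_and]
    omega

/-! ### Moving up in the dominance order -/

theorem exists_minimal_fin {n : ℕ} {P : Fin n → Prop} (h : ∃ x, P x) :
    ∃ x, P x ∧ ∀ y < x, ¬ P y := by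
  obtain ⟨x, hx, hmin⟩ := WellFounded.has_min (wellFounded_lt (α := Fin n)) {x | P x} h
  exact ⟨x, hx, fun y hy hP => hmin y hP hy⟩

/-- Take the lexicographically first entry `(i, k)` where the matrices differ; there `C` is larger.
Equal row sums give a first column `l > k` with `D i l` positive, and equal column sums give a first
row `j > i` in which `D` is positive at some column `b` with `k ≤ b < l`. Above row `j` and in
columns `k` to `l - 1`, `D` never exceeds `C`, and at `(i, k)` it is strictly smaller. -/
theorem exists_rectangle {n : ℕ} {C D : Matrix (Fin n) (Fin n) ℕ}
    (hrow : ∀ i, ∑ j, C i j = ∑ j, D i j) (hcol : ∀ j, ∑ i, C i j = ∑ i, D i j)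
    (hle : ∀ p q, rectSum D p q ≤ rectSum C p q) (hne : C ≠ D) :
    ∃ i j k l : Fin n, i < j ∧ k < l ∧ 1 ≤ D i l ∧ 1 ≤ D j k ∧
      ∀ p q : ℕ, i.val < p → p ≤ j.val → k.val < q → q ≤ l.val →
        rectSum D p q + 1 ≤ rectSum C p q := by
  have h0 : ∃ i, ∃ k, C i k ≠ D i k := by
    by_contra! h
    exact hne (by ext i k; exact h i k)
  obtain ⟨i, hi, himin⟩ := exists_minimal_fin h0
  push Not at himin
  obtain ⟨k, hk, hkmin⟩ := exists_minimal_fin hi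
  push Not at hkmin
  -- In the rectangle ending at `(i, k)` all other entries agree, so dominance decides the sign.
  have hik : D i k < C i k := by
    have h1 := hle (i.val + 1) (k.val + 1)
    by_contra hcon
    have hlt : C i k < D i k := lt_of_le_of_ne (not_lt.1 hcon) hk
    refine absurd h1 (not_le.2 ?_)
    refine Finset.sum_lt_sum ?_ ⟨(i, k), by simp, hlt⟩
    rintro ⟨a, b⟩ hab
    simp only [mem_filter, mem_univ, true_and] at hab
    rcases lt_or_eq_of_le (Nat.lt_succ_iff.1 hab.1) with ha | ha
    · exact (himin a ha b).le
    · obtain rfl : a = i := Fin.ext ha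
      rcases lt_or_eq_of_le (Nat.lt_succ_iff.1 hab.2) with hb | hb
      · exact (hkmin b hb).le
      · obtain rfl : b = k := Fin.ext hb
        exact hlt.le
  have hl : ∃ l, k < l ∧ 1 ≤ D i l := by
    by_contra! h
    refine absurd (hrow i) (ne_of_gt (Finset.sum_lt_sum ?_ ⟨k, mem_univ _, hik⟩))
    intro b _
    rcases lt_trichotomy b k with hb | rfl | hb
    · exact (hkmin b hb).ge
    · exact hik.le
    · have := h b hb
      omega
  obtain ⟨l, ⟨hkl, hDl⟩, hlmin⟩ := exists_minimal_fin hl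
  have hj : ∃ j, i < j ∧ ∃ b, k ≤ b ∧ b < l ∧ 1 ≤ D j b := by
    by_contra! h
    refine absurd (hcol k) (ne_of_gt (Finset.sum_lt_sum ?_ ⟨i, mem_univ _, hik⟩))
    intro a _
    rcases lt_trichotomy a i with ha | rfl | ha
    · exact (himin a ha k).ge
    · exact hik.le
    · have := h a ha k le_rfl hkl
      omega
  obtain ⟨j, ⟨hij, b, hkb, hbl, hDb⟩, hjmin⟩ := exists_minimal_fin hj
  refine ⟨i, j, b, l, hij, hbl, hDl, hDb, fun p q hip hpj hbq hql => ?_⟩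
  have hkb' : k.val ≤ b.val := hkb
  -- The first `k` columns are handled by dominance; the strict gain comes from the remaining ones,
  -- which contain `(i, k)`.
  rw [rectSum_eq_add C p (k := k.val) (q := q) (by omega),
    rectSum_eq_add D p (k := k.val) (q := q) (by omega), add_assoc]
  refine add_le_add (hle _ _) (Nat.succ_le_of_lt ?_)
  refine Finset.sum_lt_sum ?_ ⟨(i, k), by simp; omega, hik⟩
  rintro ⟨a, c⟩ hac
  simp only [mem_filter, mem_univ, true_and] at hac
  have hcl : c < l := Fin.lt_def.2 (by omega)
  have hkc : k ≤ c := Fin.le_def.2 (by omega)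
  rcases lt_trichotomy a i with ha | rfl | ha
  · exact (himin a ha c).ge
  · rcases hkc.eq_or_lt with rfl | hc
    · exact hik.le
    · by_contra hcon
      exact hlmin c hcl ⟨hc, by simp only at hcon; omega⟩
  · have haj : a < j := Fin.lt_def.2 (by omega)
    by_contra hcon
    exact hjmin a haj ⟨ha, c, hkc, hcl, by simp only at hcon; omega⟩

/-! ### Minors of order two -/

theorem minor_eq_det {R : Type*} [CommRing R] {n m : ℕ} (A : Matrix (Fin n) (Fin n) R)
    {I J : Finset (Fin n)} (hI : I.card = m) (hJ : J.card = m) :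
    minor A I J (hI.trans hJ.symm)
      = (A.submatrix (I.orderEmbOfFin hI) (J.orderEmbOfFin hJ)).det := by
  subst hI
  rfl

theorem minor_pair {R : Type*} [CommRing R] {n : ℕ} (A : Matrix (Fin n) (Fin n) R)
    {i j k l : Fin n} (hij : i < j) (hkl : k < l) :
    minor A {i, j} {k, l} ((card_pair hij.ne).trans (card_pair hkl.ne).symm)
      = A i k * A j l - A i l * A j k := by
  have key : ∀ {a b : Fin n} (hab : a < b),
      (({a, b} : Finset (Fin n)).orderEmbOfFin (card_pair hab.ne) : Fin 2 → Fin n) = ![a, b] := by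
    intro a b hab
    symm
    apply Finset.orderEmbOfFin_unique
    · intro x
      fin_cases x <;> simp
    · intro x y hxy
      fin_cases x <;> fin_cases y <;> simp_all
  rw [minor_eq_det A (card_pair hij.ne) (card_pair hkl.ne), Matrix.det_fin_two]
  simp [key hij, key hkl]

theorem IsTNN.entry_nonneg {n : ℕ} {A : Matrix (Fin n) (Fin n) ℝ} (hA : IsTNN A) (i j : Fin n) :
    0 ≤ A i j := by
  have h := hA {i} {j} (by simp)
  rw [minor_eq_det A (m := 1) (card_singleton _) (card_singleton _), Matrix.det_fin_one] at h
  have key : ∀ a : Fin n, ({a} : Finset (Fin n)).orderEmbOfFin (card_singleton a) 0 = a :=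
    fun a => Finset.mem_singleton.1 (Finset.orderEmbOfFin_mem _ _ _)
  simpa [key] using h

theorem aeval_xMat {n : ℕ} (A : Matrix (Fin n) (Fin n) ℝ) (i j : Fin n) :
    MvPolynomial.aeval (fun p : Fin n × Fin n => A p.1 p.2) (xMat n i j) = A i j := by
  simp [xMat]

theorem aeval_minor {n : ℕ} (A : Matrix (Fin n) (Fin n) ℝ) (I J : Finset (Fin n))
    (h : I.card = J.card) :
    MvPolynomial.aeval (fun p : Fin n × Fin n => A p.1 p.2) (minor (xMat n) I J h)
      = minor A I J h := by
  rw [minor, AlgHom.map_det, minor]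
  congr 1
  ext a b
  simp [aeval_xMat]

theorem IsSumOfMinorProducts.isTNNPoly {n r : ℕ} {M O : Fin r →o Fin n} {f : MatPoly n}
    (h : IsSumOfMinorProducts M O f) : IsTNNPoly f := by
  obtain ⟨L, hL, rfl⟩ := h
  intro A hA
  rw [map_list_sum]
  refine List.sum_nonneg ?_
  intro x hx
  obtain ⟨p, hp, rfl⟩ := List.mem_map.1 hx
  obtain ⟨-, I, J, hI, hJ, s, -, u, v, rfl⟩ := hL p hp
  rw [map_mul, map_prod, aeval_minor]
  refine mul_nonneg (hA _ _ _) (Finset.prod_nonneg fun k _ => ?_)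
  rw [aeval_xMat]
  exact hA.entry_nonneg _ _

theorem matMonomial_add_single {n : ℕ} (B : Matrix (Fin n) (Fin n) ℕ) (i j : Fin n) :
    matMonomial (B + Matrix.single i j 1) = matMonomial B * xMat n i j := by
  simp only [matMonomial, Matrix.add_apply, pow_add, Finset.prod_mul_distrib]
  congr 1
  rw [Finset.prod_eq_single i, Finset.prod_eq_single j]
  · simp
  · intro b _ hb
    simp [hb.symm]
  · simp
  · intro a _ ha
    exact Finset.prod_eq_one fun b _ => by simp [ha.symm]
  · simp

theorem sum_row_add_single {n : ℕ} (B : Matrix (Fin n) (Fin n) ℕ) (i j a : Fin n) :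
    ∑ b, (B + Matrix.single i j 1 : Matrix (Fin n) (Fin n) ℕ) a b
      = ∑ b, B a b + if i = a then 1 else 0 := by
  simp [Finset.sum_add_distrib, Matrix.single_apply, ite_and]

theorem sum_col_add_single {n : ℕ} (B : Matrix (Fin n) (Fin n) ℕ) (i j b : Fin n) :
    ∑ a, (B + Matrix.single i j 1 : Matrix (Fin n) (Fin n) ℕ) a b
      = ∑ a, B a b + if j = b then 1 else 0 := by
  simp [Finset.sum_add_distrib, Matrix.single_apply, ite_and]

/-- Since `i ≠ j`, the two units come from different entries and the truncated subtraction loses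
nothing. -/
theorem exists_eq_add_single_add_single {n : ℕ} {D : Matrix (Fin n) (Fin n) ℕ} {i j k l : Fin n}
    (hij : i ≠ j) (hil : 1 ≤ D i l) (hjk : 1 ≤ D j k) :
    ∃ B : Matrix (Fin n) (Fin n) ℕ, D = B + Matrix.single i l 1 + Matrix.single j k 1 := by
  refine ⟨Matrix.of fun a b => D a b - (if i = a ∧ l = b then 1 else 0)
    - (if j = a ∧ k = b then 1 else 0), ?_⟩
  ext a b
  simp only [Matrix.add_apply, Matrix.of_apply, Matrix.single_apply]
  by_cases h1 : i = a ∧ l = b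
  · obtain ⟨rfl, rfl⟩ := h1
    simp [hij.symm]
    omega
  · by_cases h2 : j = a ∧ k = b
    · obtain ⟨rfl, rfl⟩ := h2
      simp [hij]
      omega
    · simp [h1, h2]

theorem isMinorProduct_sub {n r : ℕ} {M O : Fin r →o Fin n} {B : Matrix (Fin n) (Fin n) ℕ}
    {i j k l : Fin n} (hij : i < j) (hkl : k < l)
    (h₁ : HasMargins M O (B + Matrix.single i k 1 + Matrix.single j l 1))
    (h₂ : HasMargins M O (B + Matrix.single i l 1 + Matrix.single j k 1)) :
    IsMinorProduct M O (matMonomial (B + Matrix.single i k 1 + Matrix.single j l 1)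
      - matMonomial (B + Matrix.single i l 1 + Matrix.single j k 1)) := by
  refine ⟨Submodule.sub_mem _ (matMonomial_mem_component h₁) (matMonomial_mem_component h₂),
    {i, j}, {k, l}, card_pair hij.ne, card_pair hkl.ne, (lexVariables B).length, ?_,
    fun a => (letter rfl a).1, fun a => (letter rfl a).2, ?_⟩
  · rw [← h₁.length_eq, length_lexVariables, length_lexVariables]
    simp only [sum_row_add_single, Finset.sum_add_distrib]
    simp
  · rw [minor_pair _ hij hkl, prod_letter rfl (fun p => xMat n p.1 p.2)]
    simp only [matMonomial_add_single]
    rw [matMonomial]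
    ring

/-- Induction on a bound `N` for the total slack between the partial sums. The move from
`exists_rectangle` raises `rectSum D` by one exactly where that lemma guarantees slack. -/
theorem isSumOfMinorProducts_of_rectSum_le {n r : ℕ} {M O : Fin r →o Fin n}
    {C : Matrix (Fin n) (Fin n) ℕ} (hC : HasMargins M O C) (N : ℕ) :
    ∀ D : Matrix (Fin n) (Fin n) ℕ, HasMargins M O D →
      (∀ p q, rectSum D p q ≤ rectSum C p q) →
      ∑ x : Fin n × Fin n, (rectSum C (x.1.val + 1) (x.2.val + 1)
        - rectSum D (x.1.val + 1) (x.2.val + 1)) ≤ N →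
      IsSumOfMinorProducts M O (matMonomial C - matMonomial D) := by
  induction N with
  | zero =>
    intro D hD hle hN
    by_cases hne : C = D
    · subst hne
      exact ⟨[], by simp, by simp⟩
    obtain ⟨i, j, k, l, hij, hkl, -, -, hlt⟩ := exists_rectangle
      (fun i => (hC.1 i).trans (hD.1 i).symm) (fun i => (hC.2 i).trans (hD.2 i).symm) hle hne
    have h1 := hlt (i.val + 1) (k.val + 1) (by omega) hij (by omega) hkl
    have h2 := Finset.sum_eq_zero_iff.1 (Nat.le_zero.1 hN) (i, k) (mem_univ _)
    simp only at h2
    omega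
  | succ N ih =>
    intro D hD hle hN
    by_cases hne : C = D
    · subst hne
      exact ⟨[], by simp, by simp⟩
    obtain ⟨i, j, k, l, hij, hkl, hil, hjk, hlt⟩ := exists_rectangle
      (fun i => (hC.1 i).trans (hD.1 i).symm) (fun i => (hC.2 i).trans (hD.2 i).symm) hle hne
    obtain ⟨B, rfl⟩ := exists_eq_add_single_add_single hij.ne hil hjk
    have hij' : i.val < j.val := hij
    have hkl' : k.val < l.val := hkl
    have hD' : HasMargins M O (B + Matrix.single i k 1 + Matrix.single j l 1) := by
      constructor
      · intro a
        rw [← hD.1 a]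
        simp only [sum_row_add_single]
      · intro b
        rw [← hD.2 b]
        simp only [sum_col_add_single]
        ring
    have hle' : ∀ p q, rectSum (B + Matrix.single i k 1 + Matrix.single j l 1) p q
        ≤ rectSum C p q := by
      intro p q
      have h1 := hle p q
      have h2 := hlt p q
      simp only [rectSum_add_single] at h1 h2 ⊢
      split_ifs at h1 h2 ⊢ <;> omega
    obtain ⟨L, hL, hsum⟩ := ih _ hD' hle' (by
      refine Nat.lt_succ_iff.1 (lt_of_lt_of_le (Finset.sum_lt_sum ?_
        ⟨(i, k), mem_univ _, ?_⟩) hN)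
      · rintro ⟨a, b⟩ -
        simp only [rectSum_add_single]
        split_ifs <;> omega
      · have h1 := hlt (i.val + 1) (k.val + 1) (by omega) hij (by omega) hkl
        simp only [rectSum_add_single] at h1 ⊢
        split_ifs at h1 ⊢ <;> omega)
    refine ⟨(matMonomial (B + Matrix.single i k 1 + Matrix.single j l 1)
        - matMonomial (B + Matrix.single i l 1 + Matrix.single j k 1)) :: L, ?_, ?_⟩
    · intro p hp
      rcases List.mem_cons.1 hp with rfl | hp
      · exact isMinorProduct_sub hij hkl hD' hD
      · exact hL p hp
    · rw [List.sum_cons, ← hsum]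
      ring

/-! ### A totally nonnegative step matrix -/

/-- The matrix with entries `2` in its upper left `p × q` corner and `1` elsewhere. -/
def stepMatrix (n p q : ℕ) : Matrix (Fin n) (Fin n) ℝ :=
  Matrix.of fun i j => if i.val < p ∧ j.val < q then 2 else 1

/-- There are only two kinds of rows, so minors of order at least three have a repeated row; smaller
ones are checked directly. -/
theorem stepMatrix_det_nonneg {n p q m : ℕ} (e f : Fin m ↪o Fin n) :
    0 ≤ ((stepMatrix n p q).submatrix e f).det := by
  match m, e, f with
  | 0, e, f => simp
  | 1, e, f =>
    rw [Matrix.det_fin_one]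
    simp only [stepMatrix, Matrix.submatrix_apply, Matrix.of_apply]
    split_ifs <;> norm_num
  | 2, e, f =>
    have he : (e 0).val < (e 1).val := e.strictMono (by simp)
    have hf : (f 0).val < (f 1).val := f.strictMono (by simp)
    rw [Matrix.det_fin_two]
    simp only [stepMatrix, Matrix.submatrix_apply, Matrix.of_apply]
    split_ifs <;> first | omega | norm_num
  | m + 3, e, f =>
    have key : ∀ a b : Fin (m + 3), a ≠ b → ((e a).val < p ↔ (e b).val < p) →
        0 ≤ ((stepMatrix n p q).submatrix e f).det := by
      intro a b hab h
      refine (Matrix.det_zero_of_row_eq hab ?_).ge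
      ext c
      simp only [stepMatrix, Matrix.submatrix_apply, Matrix.of_apply, h]
    have h1 := key ⟨0, by omega⟩ ⟨1, by omega⟩ (by simp)
    have h2 := key ⟨0, by omega⟩ ⟨2, by omega⟩ (by simp)
    have h3 := key ⟨1, by omega⟩ ⟨2, by omega⟩ (by simp)
    tauto

theorem isTNN_stepMatrix (n p q : ℕ) : IsTNN (stepMatrix n p q) :=
  fun _ _ _ => stepMatrix_det_nonneg _ _

theorem aeval_stepMatrix_matMonomial {n : ℕ} (p q : ℕ) (C : Matrix (Fin n) (Fin n) ℕ) :
    MvPolynomial.aeval (fun x : Fin n × Fin n => stepMatrix n p q x.1 x.2) (matMonomial C)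
      = 2 ^ rectSum C p q := by
  rw [matMonomial, map_prod, rectSum, ← Finset.prod_pow_eq_pow_sum, Finset.prod_filter,
    Fintype.prod_prod_type]
  refine Finset.prod_congr rfl fun i _ => ?_
  rw [map_prod]
  refine Finset.prod_congr rfl fun j _ => ?_
  rw [map_pow, aeval_xMat, stepMatrix, Matrix.of_apply]
  split_ifs <;> simp

theorem IsTNNPoly.rectSum_le {n : ℕ} {C D : Matrix (Fin n) (Fin n) ℕ}
    (h : IsTNNPoly (matMonomial C - matMonomial D)) (p q : ℕ) :
    rectSum D p q ≤ rectSum C p q := by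
  have h1 := h _ (isTNN_stepMatrix n p q)
  rw [map_sub, aeval_stepMatrix_matMonomial, aeval_stepMatrix_matMonomial, sub_nonneg] at h1
  exact (pow_le_pow_iff_right₀ (by norm_num : (1 : ℝ) < 2)).1 h1

/-! ### Rank functions of permutations -/

/-- The number of elements of `S` that `w` maps into `T`. -/
def mapCount {r : ℕ} (w : Equiv.Perm (Fin r)) (S T : Finset (Fin r)) : ℕ :=
  (S.filter fun k => w k ∈ T).card

/-- The first `p` elements of `Fin r`. -/
def initSeg (r p : ℕ) : Finset (Fin r) :=
  univ.filter fun k => k.val < p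

theorem mem_initSeg {r p : ℕ} {k : Fin r} : k ∈ initSeg r p ↔ k.val < p := by
  simp [initSeg]

/-- The number of `k` among the first `p` indices for which `w k` is among the first `q`. -/
def rk {r : ℕ} (w : Equiv.Perm (Fin r)) (p q : ℕ) : ℕ :=
  mapCount w (initSeg r p) (initSeg r q)

theorem mapCount_inv {r : ℕ} (w : Equiv.Perm (Fin r)) (S T : Finset (Fin r)) :
    mapCount w⁻¹ S T = mapCount w T S := by
  refine Finset.card_equiv w⁻¹ fun k => ?_
  simp [and_comm]

/-- Either `v` sends all of `S \ S₀` into `T`, so its gain over `S₀` is maximal, or some element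
misses `T`; then, `T` being a lower set, all of `S₁ \ S` misses it and the count on `S` equals that
on `S₁`. -/
theorem mapCount_le_of_blocks {r : ℕ} {v w : Equiv.Perm (Fin r)} {S₀ S S₁ T : Finset (Fin r)}
    (h₀ : S₀ ⊆ S) (h₁ : S ⊆ S₁) (hT : ∀ x y, x < y → y ∈ T → x ∈ T)
    (hv : ∀ k ∈ S \ S₀, ∀ l ∈ S₁ \ S, v k < v l)
    (hw₀ : mapCount w S₀ T ≤ mapCount v S₀ T) (hw₁ : mapCount w S₁ T ≤ mapCount v S₁ T) :
    mapCount w S T ≤ mapCount v S T := by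
  by_cases h : ∀ k ∈ S \ S₀, v k ∈ T
  · have hadd : ∀ u : Equiv.Perm (Fin r),
        mapCount u S T = mapCount u S₀ T + mapCount u (S \ S₀) T := by
      intro u
      unfold mapCount
      rw [← Finset.card_union_of_disjoint
        (Finset.disjoint_filter_filter Finset.disjoint_sdiff), ← Finset.filter_union,
        Finset.union_sdiff_of_subset h₀]
    have hfull : mapCount v (S \ S₀) T = (S \ S₀).card := by
      rw [mapCount, Finset.filter_true_of_mem h]
    have hle : mapCount w (S \ S₀) T ≤ (S \ S₀).card := Finset.card_filter_le _ _
    rw [hadd, hadd v]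
    omega
  · push Not at h
    obtain ⟨k, hk, hkT⟩ := h
    have heq : mapCount v S T = mapCount v S₁ T := by
      refine le_antisymm (Finset.card_le_card (Finset.filter_subset_filter _ h₁))
        (Finset.card_le_card fun l hl => ?_)
      rw [mem_filter] at hl ⊢
      refine ⟨?_, hl.2⟩
      by_contra hlS
      exact hkT (hT _ _ (hv k hk l (mem_sdiff.2 ⟨hl.1, hlS⟩)) hl.2)
    rw [heq]
    exact le_trans (Finset.card_le_card (Finset.filter_subset_filter _ h₁)) hw₁

theorem rk_succ {r : ℕ} (w : Equiv.Perm (Fin r)) (i : Fin r) (q : ℕ) :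
    rk w (i.val + 1) q = rk w i.val q + if (w i).val < q then 1 else 0 := by
  have : initSeg r (i.val + 1) = insert i (initSeg r i.val) := by
    ext k
    rw [mem_insert, mem_initSeg, mem_initSeg, Fin.ext_iff]
    omega
  unfold rk mapCount
  rw [this, Finset.filter_insert]
  simp only [mem_initSeg]
  split_ifs
  · rw [Finset.card_insert_of_notMem]
    simp [mem_initSeg]
  · rfl

/-- The lower index moved by the `i`-th adjacent transposition. -/
def lo {r : ℕ} (i : Fin (r - 1)) : Fin r := ⟨i.val, by omega⟩

/-- The upper index moved by the `i`-th adjacent transposition. -/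
def hi {r : ℕ} (i : Fin (r - 1)) : Fin r := ⟨i.val + 1, by omega⟩

theorem lo_lt_hi {r : ℕ} (i : Fin (r - 1)) : lo i < hi i := by
  simp [lo, hi, Fin.lt_def]

theorem adjSwap_eq {r : ℕ} (i : Fin (r - 1)) : adjSwap r i = Equiv.swap (lo i) (hi i) := rfl

theorem adjSwap_mul_self {r : ℕ} (i : Fin (r - 1)) : adjSwap r i * adjSwap r i = 1 := by
  simp [adjSwap_eq]

theorem adjSwap_lo {r : ℕ} (i : Fin (r - 1)) : adjSwap r i (lo i) = hi i := by
  simp [adjSwap_eq]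

theorem adjSwap_hi {r : ℕ} (i : Fin (r - 1)) : adjSwap r i (hi i) = lo i := by
  simp [adjSwap_eq]

theorem val_adjSwap {r : ℕ} (i : Fin (r - 1)) (k : Fin r) :
    (adjSwap r i k).val =
      if k.val = i.val then i.val + 1 else if k.val = i.val + 1 then i.val else k.val := by
  rw [adjSwap_eq, Equiv.swap_apply_def]
  simp only [lo, hi, Fin.ext_iff]
  split_ifs <;> rfl

theorem adjSwap_lt {r : ℕ} (i : Fin (r - 1)) {a b : Fin r} (hab : a < b)
    (hne : (a, b) ≠ (lo i, hi i)) : adjSwap r i a < adjSwap r i b := by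
  have hne' : ¬ (a.val = i.val ∧ b.val = i.val + 1) := by
    rintro ⟨h1, h2⟩
    exact hne (Prod.ext (Fin.ext h1) (Fin.ext h2))
  rw [Fin.lt_def] at hab ⊢
  rw [val_adjSwap, val_adjSwap]
  split_ifs <;> omega

theorem rk_mul_adjSwap {r : ℕ} (w : Equiv.Perm (Fin r)) (i : Fin (r - 1)) {p : ℕ}
    (hp : p ≠ i.val + 1) (q : ℕ) : rk (w * adjSwap r i) p q = rk w p q := by
  unfold rk mapCount
  refine Finset.card_equiv (adjSwap r i) fun k => ?_
  simp only [mem_filter, mem_initSeg, Equiv.Perm.mul_apply, val_adjSwap i k]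
  split_ifs <;> omega

theorem rk_hi {r : ℕ} (w : Equiv.Perm (Fin r)) (i : Fin (r - 1)) (q : ℕ) :
    rk w (i.val + 1) q = rk w i.val q + if (w (lo i)).val < q then 1 else 0 :=
  rk_succ w (lo i) q

theorem rk_hi_succ {r : ℕ} (w : Equiv.Perm (Fin r)) (i : Fin (r - 1)) (q : ℕ) :
    rk w (i.val + 2) q = rk w (i.val + 1) q + if (w (hi i)).val < q then 1 else 0 :=
  rk_succ w (hi i) q

/-! ### Length and inversions -/

/-- The number of inversions of `w`. -/
def inversions {r : ℕ} (w : Equiv.Perm (Fin r)) : ℕ :=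
  (univ.filter fun x : Fin r × Fin r => x.1 < x.2 ∧ w x.2 < w x.1).card

theorem inversions_one (r : ℕ) : inversions (1 : Equiv.Perm (Fin r)) = 0 := by
  rw [inversions, Finset.card_eq_zero, Finset.filter_eq_empty_iff]
  rintro ⟨a, b⟩ - ⟨h1, h2⟩
  exact lt_asymm h1 h2

/-- Applying the transposition to both members of a pair matches the inversions of the product,
except `(lo i, hi i)`, with those of `w`. -/
theorem inversions_mul_adjSwap {r : ℕ} {w : Equiv.Perm (Fin r)} {i : Fin (r - 1)}
    (h : w (lo i) < w (hi i)) : inversions (w * adjSwap r i) = inversions w + 1 := by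
  have hmem : (lo i, hi i) ∈ univ.filter fun x : Fin r × Fin r =>
      x.1 < x.2 ∧ (w * adjSwap r i) x.2 < (w * adjSwap r i) x.1 := by
    rw [mem_filter]
    simp [adjSwap_lo, adjSwap_hi, lo_lt_hi, h]
  rw [inversions, ← Finset.card_erase_add_one hmem, inversions]
  congr 1
  have hinv : ∀ k, adjSwap r i (adjSwap r i k) = k := fun k => by
    rw [← Equiv.Perm.mul_apply, adjSwap_mul_self, Equiv.Perm.one_apply]
  refine Finset.card_equiv ((adjSwap r i).prodCongr (adjSwap r i)) ?_
  rintro ⟨a, b⟩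
  rw [mem_erase, mem_filter, mem_filter]
  simp only [mem_univ, true_and, Equiv.Perm.mul_apply,
    Equiv.prodCongr_apply, Prod.map_apply]
  constructor
  · rintro ⟨hne, hab, hw⟩
    exact ⟨adjSwap_lt i hab hne, hw⟩
  · rintro ⟨hab, hw⟩
    have hne : (adjSwap r i a, adjSwap r i b) ≠ (lo i, hi i) := by
      intro heq
      rw [Prod.mk.injEq] at heq
      rw [heq.1, heq.2] at hw
      exact lt_asymm h hw
    have := adjSwap_lt i hab hne
    rw [hinv, hinv] at this
    refine ⟨?_, this, hw⟩
    intro heq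
    rw [Prod.mk.injEq] at heq
    rw [heq.1, heq.2, adjSwap_lo, adjSwap_hi] at hab
    exact lt_asymm hab (lo_lt_hi i)

theorem mul_adjSwap_mul_adjSwap {r : ℕ} (w : Equiv.Perm (Fin r)) (i : Fin (r - 1)) :
    w * adjSwap r i * adjSwap r i = w := by
  rw [mul_assoc, adjSwap_mul_self, mul_one]

theorem inversions_mul_adjSwap_of_gt {r : ℕ} {w : Equiv.Perm (Fin r)} {i : Fin (r - 1)}
    (h : w (hi i) < w (lo i)) : inversions (w * adjSwap r i) + 1 = inversions w := by
  rw [← inversions_mul_adjSwap (w := w * adjSwap r i) (i := i), mul_adjSwap_mul_adjSwap]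
  simpa [adjSwap_lo, adjSwap_hi] using h

theorem apply_lo_lt_or_gt {r : ℕ} (w : Equiv.Perm (Fin r)) (i : Fin (r - 1)) :
    w (lo i) < w (hi i) ∨ w (hi i) < w (lo i) :=
  lt_or_gt_of_ne fun h => (lo_lt_hi i).ne (w.injective h)

theorem eq_one_of_ascents {r : ℕ} {w : Equiv.Perm (Fin r)}
    (h : ∀ i : Fin (r - 1), w (lo i) < w (hi i)) : w = 1 := by
  have hmono : StrictMono w := by
    match r, w, h with
    | 0, w, h => exact fun a => a.elim0
    | r + 1, w, h => exact Fin.strictMono_iff_lt_succ.2 fun i => h i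
  have hinv : StrictMono (w⁻¹ : Equiv.Perm (Fin r)) := by
    intro a b hab
    rw [← hmono.lt_iff_lt]
    simpa using hab
  ext k
  have h1 : k ≤ w k := hmono.le_apply
  have h2 : w k ≤ w⁻¹ (w k) := hinv.le_apply
  rw [Equiv.Perm.coe_inv, Equiv.symm_apply_apply] at h2
  exact congrArg Fin.val (le_antisymm h2 h1)

/-- Bubble sort: a permutation with an inversion has a descent, and undoing it removes exactly one
inversion. -/
theorem exists_word_of_length_inversions {r : ℕ} (N : ℕ) : ∀ w : Equiv.Perm (Fin r),
    inversions w = N → ∃ a : List (Fin (r - 1)), (a.map (adjSwap r)).prod = w ∧ a.length = N := by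
  induction N with
  | zero =>
    intro w hw
    refine ⟨[], ?_, rfl⟩
    rw [List.map_nil, List.prod_nil]
    refine (eq_one_of_ascents fun i => ?_).symm
    rcases apply_lo_lt_or_gt w i with h | h
    · exact h
    · have := inversions_mul_adjSwap_of_gt h
      omega
  | succ N ih =>
    intro w hw
    have : ∃ i : Fin (r - 1), w (hi i) < w (lo i) := by
      by_contra! h
      have h1 := eq_one_of_ascents fun i =>
        (apply_lo_lt_or_gt w i).resolve_right (not_lt.2 (h i))
      rw [h1, inversions_one] at hw
      omega
    obtain ⟨i, hi⟩ := this
    obtain ⟨a, ha, hlen⟩ := ih (w * adjSwap r i) (by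
      have := inversions_mul_adjSwap_of_gt hi
      omega)
    exact ⟨a ++ [i], by simp [ha, mul_adjSwap_mul_adjSwap], by simp [hlen]⟩

theorem inversions_prod_le {r : ℕ} (a : List (Fin (r - 1))) :
    inversions (a.map (adjSwap r)).prod ≤ a.length := by
  induction a using List.reverseRecOn with
  | nil => simp [inversions_one]
  | append_singleton a i ih =>
    rw [List.map_append, List.prod_append, List.map_singleton, List.prod_singleton,
      List.length_append, List.length_singleton]
    rcases apply_lo_lt_or_gt (a.map (adjSwap r)).prod i with h | h
    · rw [inversions_mul_adjSwap h]
      omega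
    · have := inversions_mul_adjSwap_of_gt h
      omega

theorem isReducedExpr_iff {r : ℕ} {a : List (Fin (r - 1))} {w : Equiv.Perm (Fin r)} :
    IsReducedExpr a w ↔ (a.map (adjSwap r)).prod = w ∧ a.length = inversions w := by
  constructor
  · rintro ⟨rfl, h⟩
    obtain ⟨b, hb, hlen⟩ := exists_word_of_length_inversions _ (a.map (adjSwap r)).prod rfl
    exact ⟨rfl, le_antisymm (hlen ▸ h b hb) (inversions_prod_le a)⟩
  · rintro ⟨h1, h2⟩
    refine ⟨h1, fun b hb => ?_⟩
    rw [h2, ← hb]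
    exact inversions_prod_le b

theorem exists_isReducedExpr {r : ℕ} (w : Equiv.Perm (Fin r)) :
    ∃ a : List (Fin (r - 1)), IsReducedExpr a w := by
  obtain ⟨a, ha⟩ := exists_word_of_length_inversions _ w rfl
  exact ⟨a, isReducedExpr_iff.2 ha⟩

theorem isReducedExpr_append_singleton {r : ℕ} {a : List (Fin (r - 1))} {i : Fin (r - 1)}
    {w : Equiv.Perm (Fin r)} :
    IsReducedExpr (a ++ [i]) w ↔
      IsReducedExpr a (w * adjSwap r i) ∧ w (hi i) < w (lo i) := by
  have hprod : ((a ++ [i]).map (adjSwap r)).prod = w ↔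
      (a.map (adjSwap r)).prod = w * adjSwap r i := by
    rw [List.map_append, List.prod_append, List.map_singleton, List.prod_singleton]
    constructor
    · rintro rfl
      rw [mul_adjSwap_mul_adjSwap]
    · intro h
      rw [h, mul_adjSwap_mul_adjSwap]
  rw [isReducedExpr_iff, isReducedExpr_iff, hprod, List.length_append, List.length_singleton,
    and_assoc]
  refine and_congr_right fun ha => ?_
  rcases apply_lo_lt_or_gt w i with h | h
  · have h1 := inversions_mul_adjSwap h
    have h2 := inversions_prod_le a
    rw [ha] at h2
    simp only [h.not_gt, and_false, iff_false]
    omega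
  · have h1 := inversions_mul_adjSwap_of_gt h
    simp only [h, and_true]
    omega

/-! ### The rank criterion for the Bruhat order -/

/-- If `v (lo i) < q`, the rank of `v` gains one from `i` to `i + 1`, and the bound at `i` suffices.
Otherwise it is constant from `i + 1` to `i + 2`, and the bound at `i + 2` suffices. -/
theorem rk_le_of_ascent {r : ℕ} {v w : Equiv.Perm (Fin r)} {i : Fin (r - 1)}
    (hv : v (lo i) < v (hi i)) (h : ∀ p, p ≠ i.val + 1 → ∀ q, rk w p q ≤ rk v p q) (p q : ℕ) :
    rk w p q ≤ rk v p q := by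
  by_cases hp : p = i.val + 1
  · subst hp
    have h0 := h i.val (by omega) q
    have h2 := h (i.val + 2) (by omega) q
    rw [Fin.lt_def] at hv
    simp only [rk_hi_succ, rk_hi] at h2 ⊢
    split_ifs at h2 ⊢ <;> omega
  · exact h p hp q

theorem rk_mul_adjSwap_le {r : ℕ} {w : Equiv.Perm (Fin r)} {i : Fin (r - 1)}
    (hw : w (lo i) < w (hi i)) (p q : ℕ) : rk (w * adjSwap r i) p q ≤ rk w p q := by
  by_cases hp : p = i.val + 1
  · subst hp
    rw [rk_hi, rk_hi, rk_mul_adjSwap w i (by omega), Equiv.Perm.mul_apply, adjSwap_lo]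
    rw [Fin.lt_def] at hw
    split_ifs <;> omega
  · rw [rk_mul_adjSwap w i hp]

theorem rk_mul_adjSwap_le_mul_adjSwap {r : ℕ} {v w : Equiv.Perm (Fin r)} {i : Fin (r - 1)}
    (hw : w (lo i) < w (hi i)) (h : ∀ p q, rk w p q ≤ rk v p q) (p q : ℕ) :
    rk (w * adjSwap r i) p q ≤ rk (v * adjSwap r i) p q := by
  by_cases hp : p = i.val + 1
  · subst hp
    rw [rk_hi, rk_hi, rk_mul_adjSwap w i (by omega), rk_mul_adjSwap v i (by omega),
      Equiv.Perm.mul_apply, Equiv.Perm.mul_apply, adjSwap_lo]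
    have h0 := h i.val q
    have h2 := h (i.val + 2) q
    rw [Fin.lt_def] at hw
    simp only [rk_hi_succ, rk_hi] at h2
    split_ifs at h2 ⊢ <;> omega
  · rw [rk_mul_adjSwap w i hp, rk_mul_adjSwap v i hp]
    exact h p q

/-- Only `a` has to be reduced: its last letter is then a descent of `w`, which covers both keeping
and dropping that letter in `b`. -/
theorem rk_le_of_sublist {r : ℕ} (a : List (Fin (r - 1))) :
    ∀ (w : Equiv.Perm (Fin r)) (b : List (Fin (r - 1))), IsReducedExpr a w → b.Sublist a →
      ∀ p q, rk w p q ≤ rk (b.map (adjSwap r)).prod p q := by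
  induction a using List.reverseRecOn with
  | nil =>
    intro w b ha hb p q
    rw [List.sublist_nil.1 hb, ha.1]
  | append_singleton a i ih =>
    intro w b ha hb p q
    rw [isReducedExpr_append_singleton] at ha
    obtain ⟨ha, hw⟩ := ha
    have hw' : (w * adjSwap r i) (lo i) < (w * adjSwap r i) (hi i) := by
      simpa [adjSwap_lo, adjSwap_hi] using hw
    rw [← mul_adjSwap_mul_adjSwap w i]
    obtain ⟨b₁, b₂, rfl, hb₁, hb₂⟩ := List.sublist_append_iff.1 hb
    have h1 := ih _ _ ha hb₁
    rcases List.sublist_singleton.1 hb₂ with rfl | rfl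
    · rw [List.append_nil]
      exact (rk_mul_adjSwap_le hw' p q).trans (h1 p q)
    · rw [List.map_append, List.prod_append, List.map_singleton, List.prod_singleton]
      exact rk_mul_adjSwap_le_mul_adjSwap hw' h1 p q

/-- Let `i` be the last letter of `a`. If `v` ascends at `i`, it is found below `w * adjSwap r i`;
if it descends, `v * adjSwap r i` is found there and `i` is appended. -/
theorem exists_sublist_of_rk_le {r : ℕ} (a : List (Fin (r - 1))) :
    ∀ v w : Equiv.Perm (Fin r), IsReducedExpr a w → (∀ p q, rk w p q ≤ rk v p q) →
      ∃ b : List (Fin (r - 1)), b.Sublist a ∧ IsReducedExpr b v := by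
  induction a using List.reverseRecOn with
  | nil =>
    intro v w ha h
    obtain rfl : 1 = w := ha.1
    refine ⟨[], List.Sublist.refl _, ?_⟩
    suffices v = 1 by rwa [this]
    refine eq_one_of_ascents fun i => ?_
    by_contra hcon
    have hcon := (apply_lo_lt_or_gt v i).resolve_left hcon
    -- Maximal ranks force `v` to preserve initial segments. With a descent at `i`, the segment of
    -- size `i + 1` gives `v (hi i) < i`, although `v` already maps the segment of size `i` onto
    -- itself.
    have key : ∀ q ≤ r, rk (1 : Equiv.Perm (Fin r)) q q = q := by
      intro q hq
      rw [rk, mapCount, Finset.filter_true_of_mem (by simp), initSeg, Fin.card_filter_val_lt,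
        min_eq_right hq]
    have hq : i.val + 1 ≤ r := by omega
    have hv : (v (lo i)).val < i.val + 1 := by
      have h1 := h (i.val + 1) (i.val + 1)
      rw [key _ hq] at h1
      have h2 : (initSeg r (i.val + 1)).card = i.val + 1 := by
        rw [initSeg, Fin.card_filter_val_lt, min_eq_right hq]
      have h3 := Finset.filter_card_eq (le_antisymm (Finset.card_filter_le _ _)
        (h2.le.trans h1)) (lo i) (mem_initSeg.2 (by simp [lo]))
      exact mem_initSeg.1 h3
    have h1 := h i.val i.val
    rw [key _ (by omega)] at h1
    have h2 : (initSeg r i.val).card = i.val := by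
      rw [initSeg, Fin.card_filter_val_lt, min_eq_right (by omega)]
    have hS : ∀ k ∈ initSeg r i.val, v k ∈ initSeg r i.val := Finset.filter_card_eq
      (le_antisymm (Finset.card_filter_le _ _) (h2.le.trans h1))
    have himg : (initSeg r i.val).image v = initSeg r i.val :=
      Finset.eq_of_subset_of_card_le (Finset.image_subset_iff.2 hS)
        (Finset.card_image_of_injective _ v.injective).ge
    have hmem : v (hi i) ∈ (initSeg r i.val).image v := by
      rw [himg, mem_initSeg]
      rw [Fin.lt_def] at hcon
      omega
    obtain ⟨k, hk, hkv⟩ := Finset.mem_image.1 hmem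
    rw [v.injective hkv, mem_initSeg] at hk
    simp [hi] at hk
  | append_singleton a i ih =>
    intro v w ha h
    rw [isReducedExpr_append_singleton] at ha
    obtain ⟨ha, -⟩ := ha
    rcases apply_lo_lt_or_gt v i with hv | hv
    · obtain ⟨b, hb, hbv⟩ := ih v _ ha (rk_le_of_ascent hv fun p hp q => by
        rw [rk_mul_adjSwap w i hp]
        exact h p q)
      exact ⟨b, hb.trans (List.sublist_append_left _ _), hbv⟩
    · obtain ⟨b, hb, hbv⟩ := ih (v * adjSwap r i) _ ha (rk_le_of_ascent (i := i)
        (by simpa [adjSwap_lo, adjSwap_hi] using hv) fun p hp q => by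
          rw [rk_mul_adjSwap w i hp, rk_mul_adjSwap v i hp]
          exact h p q)
      exact ⟨b ++ [i], hb.append (List.Sublist.refl _),
        isReducedExpr_append_singleton.2 ⟨hbv, hv⟩⟩

theorem bruhatLE_iff_rk_le {r : ℕ} {v w : Equiv.Perm (Fin r)} :
    BruhatLE v w ↔ ∀ p q, rk w p q ≤ rk v p q := by
  constructor
  · intro h
    obtain ⟨a, ha⟩ := exists_isReducedExpr w
    obtain ⟨b, hb, hbv⟩ := h a ha
    rw [← hbv.1]
    exact rk_le_of_sublist a w b ha hb
  · exact fun h a ha => exists_sublist_of_rk_le a v w ha h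

/-! ### Dominance and the Bruhat order -/

section Margins

variable {n r : ℕ} {M O : Fin r →o Fin n} {C D : Matrix (Fin n) (Fin n) ℕ}

/-- The positions of the letters of `M` that are among the first `i`. -/
def letterSeg (M : Fin r →o Fin n) (i : ℕ) : Finset (Fin r) :=
  univ.filter fun k => (M k).val < i

theorem mem_letterSeg {i : ℕ} {k : Fin r} : k ∈ letterSeg M i ↔ (M k).val < i := by
  simp [letterSeg]

theorem mapCount_wPerm (h : HasMargins M O C) (i j : ℕ) :
    mapCount (wPerm h) (letterSeg M i) (letterSeg O j) = rectSum C i j := by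
  have h1 := card_letter h.length_eq (fun p => p.1.val < i ∧ p.2.val < j)
  rw [rectSum, Finset.sum_filter, Fintype.sum_prod_type, ← h1, mapCount]
  congr 1
  ext k
  rw [mem_filter, mem_filter, mem_letterSeg, mem_letterSeg, letter_fst h, letter_snd h,
    columnWord_eq]
  simp only [mem_univ, true_and]

/-- Every initial segment lies between two unions of blocks of equal letters of `M` that differ
by at most one block. -/
theorem exists_letterSeg (M : Fin r →o Fin n) (p : ℕ) :
    ∃ i j, letterSeg M i ⊆ initSeg r p ∧ initSeg r p ⊆ letterSeg M j ∧
      ∀ k ∈ initSeg r p \ letterSeg M i, ∀ l ∈ letterSeg M j \ initSeg r p,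
        k < l ∧ M k = M l := by
  by_cases hp : p < r
  · refine ⟨(M ⟨p, hp⟩).val, (M ⟨p, hp⟩).val + 1, ?_, ?_, ?_⟩
    · intro k hk
      rw [mem_letterSeg] at hk
      rw [mem_initSeg]
      by_contra hcon
      have h1 : M ⟨p, hp⟩ ≤ M k := M.monotone (Fin.le_def.2 (not_lt.1 hcon))
      rw [Fin.le_def] at h1
      omega
    · intro k hk
      rw [mem_initSeg] at hk
      rw [mem_letterSeg]
      have h1 : M k ≤ M ⟨p, hp⟩ := M.monotone (Fin.le_def.2 hk.le)
      rw [Fin.le_def] at h1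
      omega
    · intro k hk l hl
      rw [mem_sdiff, mem_letterSeg, mem_initSeg] at hk hl
      have hkl : k < l := Fin.lt_def.2 (by omega)
      have h1 : M k ≤ M l := M.monotone hkl.le
      refine ⟨hkl, le_antisymm h1 (Fin.le_def.2 (by omega))⟩
  · refine ⟨n, n, ?_, ?_, ?_⟩
    · intro k _
      rw [mem_initSeg]
      omega
    · intro k _
      rw [mem_letterSeg]
      exact (M k).isLt
    · intro k hk
      rw [mem_sdiff, mem_letterSeg] at hk
      exact absurd (M k).isLt hk.2

/-- Monotonicity of `M` makes the set a lower set, so its cardinality serves as `p`. -/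
theorem exists_initSeg (M : Fin r →o Fin n) (i : ℕ) : ∃ p, initSeg r p = letterSeg M i := by
  obtain ⟨p, hp⟩ : ∃ p, p = (letterSeg M i).card := ⟨_, rfl⟩
  refine ⟨p, (Finset.eq_of_subset_of_card_le (fun k hk => ?_) ?_).symm⟩
  · rw [mem_initSeg, hp]
    have hsub : initSeg r (k.val + 1) ⊆ letterSeg M i := by
      intro l hl
      rw [mem_initSeg] at hl
      rw [mem_letterSeg] at hk ⊢
      have h1 : M l ≤ M k := M.monotone (Fin.le_def.2 (by omega))
      rw [Fin.le_def] at h1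
      omega
    have h1 := Finset.card_le_card hsub
    rw [initSeg, Fin.card_filter_val_lt, min_eq_right k.isLt] at h1
    omega
  · rw [initSeg, Fin.card_filter_val_lt, hp]
    exact min_le_right _ _

theorem bruhatLE_wPerm_iff (hC : HasMargins M O C) (hD : HasMargins M O D) :
    BruhatLE (wPerm hC) (wPerm hD) ↔ ∀ i j, rectSum D i j ≤ rectSum C i j := by
  rw [bruhatLE_iff_rk_le]
  constructor
  · intro h i j
    obtain ⟨p, hp⟩ := exists_initSeg M i
    obtain ⟨q, hq⟩ := exists_initSeg O j
    rw [← mapCount_wPerm hC, ← mapCount_wPerm hD, ← hp, ← hq]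
    exact h p q
  · intro h p q
    -- Interpolation is done in two passes: first in positions, with values cut at block ends of
    -- `O`, then in values by passing to inverses. Only the monotonicity of `wPerm hC` on blocks
    -- enters.
    have hrow : ∀ j, mapCount (wPerm hD) (initSeg r p) (letterSeg O j)
        ≤ mapCount (wPerm hC) (initSeg r p) (letterSeg O j) := by
      intro j
      obtain ⟨i₀, i₁, h₀, h₁, hM⟩ := exists_letterSeg M p
      refine mapCount_le_of_blocks h₀ h₁ ?_ (fun k hk l hl =>
        wPerm_lt_of_row_eq hC (hM k hk l hl).1 (hM k hk l hl).2) ?_ ?_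
      · intro x y hxy hy
        rw [mem_letterSeg] at hy ⊢
        exact lt_of_le_of_lt (Fin.le_def.1 (O.monotone hxy.le)) hy
      · rw [mapCount_wPerm, mapCount_wPerm]
        exact h _ _
      · rw [mapCount_wPerm, mapCount_wPerm]
        exact h _ _
    obtain ⟨j₀, j₁, h₀, h₁, hO⟩ := exists_letterSeg O q
    rw [rk, rk, ← mapCount_inv (wPerm hD), ← mapCount_inv (wPerm hC)]
    refine mapCount_le_of_blocks h₀ h₁ ?_ (fun k hk l hl =>
      wPerm_inv_lt_of_col_eq hC (hO k hk l hl).1 (hO k hk l hl).2) ?_ ?_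
    · intro x y hxy hy
      rw [mem_initSeg] at hy ⊢
      exact lt_trans (Fin.lt_def.1 hxy) hy
    · rw [mapCount_inv, mapCount_inv]
      exact hrow _
    · rw [mapCount_inv, mapCount_inv]
      exact hrow _

end Margins

end TNNOrder

theorem theorem2p5 {n r : ℕ} (M O : Fin r →o Fin n) (C D : Matrix (Fin n) (Fin n) ℕ)
    (hC : TNNOrder.HasMargins M O C) (hD : TNNOrder.HasMargins M O D) :
    TNNOrder.matMonomial C - TNNOrder.matMonomial D ∈ TNNOrder.component M O ∧
    List.TFAE [
      TNNOrder.IsTNNPoly (TNNOrder.matMonomial C - TNNOrder.matMonomial D),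
      ∀ i j, TNNOrder.partialSums D i j ≤ TNNOrder.partialSums C i j,
      TNNOrder.BruhatLE (TNNOrder.wPerm hC) (TNNOrder.wPerm hD),
      TNNOrder.IsSumOfMinorProducts M O
        (TNNOrder.matMonomial C - TNNOrder.matMonomial D)] := by
  refine ⟨Submodule.sub_mem _ (TNNOrder.matMonomial_mem_component hC)
    (TNNOrder.matMonomial_mem_component hD), ?_⟩
  -- After this, (ii) and (iii) are literally the same dominance statement.
  rw [TNNOrder.rectSum_le_iff, TNNOrder.bruhatLE_wPerm_iff hC hD]
  tfae_have 1 → 2 := fun h => h.rectSum_le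
  tfae_have 2 → 4 := fun h =>
    TNNOrder.isSumOfMinorProducts_of_rectSum_le hC _ D hD h le_rfl
  tfae_have 4 → 1 := fun h => h.isTNNPoly
  tfae_have 2 ↔ 3 := Iff.rfl
  tfae_finish
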